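/- Let $\Sigma$ be a finite alphabet, let $\mathsf{Vars}$ be an infinite set of variables disjoint from $\Sigma$, and let $\mathsf{Docs}=\Sigma^*$. A $k$-ary string relation ($k\ge 0$) is a set $R\subseteq\mathsf{Docs}^k$; it is *recognizable* if it is a finite union of Cartesian products $L_1\times\cdots\times L_k$ of regular languages $L_i\subseteq\Sigma^*$. A *span* of a document $d=\sigma_1\cdots\sigma_n$ is an expression $[i,j\rangle$ with $1\le i\le j\le n+1$, and $d_{[i,j\rangle}=\sigma_i\cdots\sigma_{j-1}$. Let $(\mathbb K,\oplus,\otimes,\bar 0,\bar 1)$ be a commutative semiring. It is *bipotent* if $a\oplus b\in\{a,b\}$ for all $a,b$, and *positive* if $\bar 0\ne\bar 1$, $a\oplus b=\bar 0$ implies $a=b=\bar 0$, and $a\otimes b=\bar 0$ implies $a=\bar 0$ or $b=\bar 0$. A *$\mathbb K$-annotator* $S$ with finite variable set $V\subseteq\mathsf{Vars}$ assigns to every document $d$ and every map $t$ from $V$ to the spans of $d$ a weight $S(d)(t)\in\mathbb K$. A *$\mathbb K$-weighted VSet-automaton* with variable set $V$ consists of a finite set $Q$ of states, weight functions $I,F:Q\to\mathbb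 K$, and $\delta:Q\times(\Sigma\cup\{\varepsilon\}\cup\{\vdash_v,\dashv_v: v\in V\})\times Q\to\mathbb K$, such that no state can be reached from itself by one or more $\varepsilon$-transitions of nonzero weight. A run on $d$ is a sequence $q_0\xrightarrow{o_1}q_1\cdots\xrightarrow{o_m}q_m$ with $I(q_0)$, $F(q_m)$ and all $\delta(q_{l-1},o_l,q_l)$ nonzero, in which the letters among $o_1,\dots,o_m$ spell $d$; its weight is $I(q_0)\otimes\delta(q_0,o_1,q_1)\otimes\cdots\otimes\delta(q_{m-1},o_m,q_m)\otimes F(q_m)$. It is *valid* if for every $v\in V$ each of $\vdash_v$ and $\dashv_v$ occurs exactly once, $\vdash_v$ before $\dashv_v$; it then defines the map $t$ with $t(v)=[i,j\rangle$, where $i-1$ (resp. $j-1$) letters are read before $\vdash_v$ (resp. $\dashv_v$). The automaton defines the annotator for which $S(d)(t)$ is the $\oplus$-sum of the weights of all valid runs on $d$ of nonzero weight that define $t$. An annotator is *regular* if some $\mathbb K$-weighted VSet-automaton defines it. For an annotator $S$ with variable set $V$ and $x_1,\dots,x_k\in V$, the string selection $\sigma^R_{x_1,\dots,x_k}(S)$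 is the annotator with variable set $V$ whose value at $(d,t)$ is $S(d)(t)$ if $(d_{t(x_1)},\dots,d_{t(x_k)})\in R$, and $\bar 0$ otherwise. The relation $R$ is *selectable by $\mathbb K$-annotators* if for every regular $\mathbb K$-annotator $S$ and all variables $x_1,\dots,x_k$ of $S$, the annotator $\sigma^R_{x_1,\dots,x_k}(S)$ is regular. **Statement.** Let $R$ be a string relation over $\Sigma$. 1. Let $\mathbb K$ be a bipotent commutative semiring with $\bar 0\neq\bar 1$ in which $a\otimes b=\bar 1$ implies $a=b=\bar 1$. Then $R$ is recognizable if and only if $R$ is selectable by $\mathbb K$-annotators. 2. The Łukasiewicz semiring, with domain $[0,1]$, addition $\max(x,y)$, multiplication $\max(0,x+y-1)$, zero $0$ and one $1$, is not positive, and $R$ is recognizable if and only if $R$ is selectable by annotators over the Łukasiewicz semiring. -/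

import Mathlib

/-! Regular annotators over commutative semirings, string selection, recognizable string relations. -/

namespace KAnnotators

/-! ### Semirings -/

/-- Addition always returns one of its two arguments. -/
def IsBipotent (K : Type*) [CommSemiring K] : Prop :=
  ∀ a b : K, a + b = a ∨ a + b = b

/-- Positive semirings: `0 ≠ 1`, no nonzero additive inverses, no zero divisors. -/
def IsPositive (K : Type*) [CommSemiring K] : Prop :=
  (0 : K) ≠ 1 ∧ (∀ a b : K, a + b = 0 → a = 0 ∧ b = 0) ∧
    (∀ a b : K, a * b = 0 → a = 0 ∨ b = 0)

/-- The domain `[0, 1]` of the Łukasiewicz semiring. -/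
@[ext]
structure Lukasiewicz where
  val : ℝ
  nonneg : 0 ≤ val
  le_one : val ≤ 1

namespace Lukasiewicz

noncomputable instance : Zero Lukasiewicz := ⟨⟨0, le_refl _, zero_le_one⟩⟩

noncomputable instance : One Lukasiewicz := ⟨⟨1, zero_le_one, le_refl _⟩⟩

/-- Addition is the maximum. -/
noncomputable instance : Add Lukasiewicz :=
  ⟨fun x y => ⟨max x.val y.val, le_max_of_le_left x.nonneg, max_le x.le_one y.le_one⟩⟩

/-- Multiplication is `max (0, x + y - 1)`. -/
noncomputable instance : Mul Lukasiewicz :=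
  ⟨fun x y => ⟨max 0 (x.val + y.val - 1), le_max_left _ _,
    max_le zero_le_one (by linarith [x.le_one, y.le_one])⟩⟩

theorem val_zero : (0 : Lukasiewicz).val = 0 := rfl

theorem val_one : (1 : Lukasiewicz).val = 1 := rfl

theorem val_add (x y : Lukasiewicz) : (x + y).val = max x.val y.val := rfl

theorem val_mul (x y : Lukasiewicz) : (x * y).val = max 0 (x.val + y.val - 1) := rfl

theorem add_comm' (x y : Lukasiewicz) : x + y = y + x :=
  Lukasiewicz.ext (max_comm _ _)

theorem mul_comm' (x y : Lukasiewicz) : x * y = y * x := by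
  ext
  rw [val_mul, val_mul, add_comm x.val]

theorem add_mul' (x y z : Lukasiewicz) : (x + y) * z = x * z + y * z := by
  ext
  simp only [val_mul, val_add]
  rcases le_total x.val y.val with h | h
  · rw [max_eq_right h, max_eq_right (max_le_max le_rfl (by linarith))]
  · rw [max_eq_left h, max_eq_left (max_le_max le_rfl (by linarith))]

theorem mul_assoc' (x y z : Lukasiewicz) : x * y * z = x * (y * z) := by
  ext
  have hx := x.le_one
  have hz := z.le_one
  simp only [val_mul]
  rcases le_total 0 (x.val + y.val - 1) with h | h <;>
    rcases le_total 0 (y.val + z.val - 1) with h' | h'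
  · rw [max_eq_right h, max_eq_right h']
    congr 1
    ring
  · rw [max_eq_right h, max_eq_left h', max_eq_left (by linarith), max_eq_left (by linarith)]
  · rw [max_eq_left h, max_eq_right h', max_eq_left (by linarith), max_eq_left (by linarith)]
  · rw [max_eq_left h, max_eq_left h', max_eq_left (by linarith), max_eq_left (by linarith)]

theorem zero_mul' (x : Lukasiewicz) : 0 * x = 0 := by
  ext
  rw [val_mul, val_zero, max_eq_left (by linarith [x.le_one])]

theorem one_mul' (x : Lukasiewicz) : 1 * x = x := by
  ext
  rw [val_mul, val_one, add_sub_cancel_left, max_eq_right x.nonneg]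

theorem zero_add' (x : Lukasiewicz) : 0 + x = x :=
  Lukasiewicz.ext (max_eq_right x.nonneg)

/-- The Łukasiewicz semiring `([0, 1], max, max (0, x + y - 1), 0, 1)`. -/
noncomputable instance : CommSemiring Lukasiewicz where
  add_assoc x y z := Lukasiewicz.ext (max_assoc _ _ _)
  zero_add := zero_add'
  add_zero x := by rw [add_comm', zero_add']
  add_comm := add_comm'
  mul_assoc := mul_assoc'
  one_mul := one_mul'
  mul_one x := by rw [mul_comm', one_mul']
  zero_mul := zero_mul'
  mul_zero x := by rw [mul_comm', zero_mul']
  left_distrib x y z := by rw [mul_comm', add_mul', mul_comm' y, mul_comm' z]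
  right_distrib := add_mul'
  mul_comm := mul_comm'
  nsmul := nsmulRec

end Lukasiewicz

/-! ### Documents, spans, annotators

A document over the alphabet `Sig` is a `List Sig`. -/

/-- A span of `d`. Positions are counted from `0` (the number of letters to the left), so the span
written `[i, j⟩` with `1 ≤ i ≤ j ≤ |d| + 1` has `left = i - 1` and `right = j - 1`. -/
@[ext]
structure Span {Sig : Type*} (d : List Sig) where
  left : ℕ
  right : ℕ
  left_le_right : left ≤ right
  right_le_length : right ≤ d.length

/-- A document has only finitely many spans, so that every function on the `V`-tuples of spans
of `d` has finite support when `V` is finite. -/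
instance {Sig : Type*} (d : List Sig) : Finite (Span d) :=
  Finite.of_injective
    (fun s : Span d => ((⟨s.left, by have := s.left_le_right; have := s.right_le_length; omega⟩,
      ⟨s.right, by have := s.right_le_length; omega⟩) : Fin (d.length + 1) × Fin (d.length + 1)))
    (fun s t h => by
      simp only [Prod.mk.injEq, Fin.mk.injEq] at h
      exact Span.ext h.1 h.2)

/-- The substring of `d` that a span identifies. -/
def Span.substring {Sig : Type*} {d : List Sig} (s : Span d) : List Sig :=
  (d.drop s.left).take (s.right - s.left)

/-- A `K`-annotator with variable set `V` maps every document `d` to a `K`-relation over `V`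
whose tuples take values in the spans of `d`. -/
abbrev Annotator (K Sig : Type*) {Var : Type*} (V : Finset Var) :=
  (d : List Sig) → (V → Span d) → K

open scoped Classical in
/-- String selection: the weight of `t` is multiplied by `1` if the strings at the spans
`t (x 1), …, t (x k)` are in the relation `R`, and by `0` otherwise. -/
noncomputable def Annotator.select {K Sig Var : Type*} [CommSemiring K] {V : Finset Var} {k : ℕ}
    (S : Annotator K Sig V) (R : Set (Fin k → List Sig)) (x : Fin k → V) : Annotator K Sig V :=
  fun d t => S d t * (if (fun i => (t (x i)).substring) ∈ R then 1 else 0)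

/-! ### Weighted variable-set automata -/

/-- Transition labels: letters, the empty word, and the operations that open or close a
variable in `V`. -/
inductive Label (Sig : Type*) {Var : Type*} (V : Finset Var) where
  | letter (a : Sig)
  | eps
  | opening (v : V)
  | closing (v : V)

/-- The letter that a label reads, if any. -/
def Label.read {Sig Var : Type*} {V : Finset Var} : Label Sig V → Option Sig
  | .letter a => some a
  | _ => none

/-- The string read by a sequence of labels. -/
def readWord {Sig Var : Type*} {V : Finset Var} (o : List (Label Sig V)) : List Sig :=
  o.filterMap Label.read

/-- The position in the document (counted from `0`) at which the label with index `i` of `o` is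
executed: the number of letters read by the labels before it. -/
def position {Sig Var : Type*} {V : Finset Var} (o : List (Label Sig V)) (i : ℕ) : ℕ :=
  (readWord (o.take i)).length

/-- Every variable is opened exactly once and closed exactly once, after it has been opened. -/
def IsValid {Sig Var : Type*} {V : Finset Var} (o : List (Label Sig V)) : Prop :=
  ∀ v : V, ∃ i j : ℕ, i < j ∧
    (∀ l, o[l]? = some (Label.opening v) ↔ l = i) ∧
    (∀ l, o[l]? = some (Label.closing v) ↔ l = j)

/-- The tuple `t` maps every variable `v` to the span between the position at which `v` is opened
and the position at which `v` is closed. For valid `o` this determines `t`. -/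
def HasTuple {Sig Var : Type*} {V : Finset Var} (o : List (Label Sig V)) {d : List Sig}
    (t : V → Span d) : Prop :=
  ∀ (v : V) (i j : ℕ), o[i]? = some (Label.opening v) → o[j]? = some (Label.closing v) →
    (t v).left = position o i ∧ (t v).right = position o j

/-- A `K`-weighted variable-set automaton over the alphabet `Sig` with variable set `V`. -/
structure WeightedVSetAutomaton (K Sig : Type*) {Var : Type*} (V : Finset Var) where
  State : Type
  finite_state : Finite State
  initialWeight : State → K
  finalWeight : State → K
  transWeight : State → Label Sig V → State → K

namespace WeightedVSetAutomaton

variable {K Sig Var : Type*} [CommSemiring K] {V : Finset Var}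

/-- No state can be reached from itself by one or more `ε`-transitions of nonzero weight. -/
def NoEpsCycle (A : WeightedVSetAutomaton K Sig V) : Prop :=
  ∀ q : A.State, ¬ Relation.TransGen (fun p p' => A.transWeight p Label.eps p' ≠ 0) q q

/-- A candidate run: a first state and a list of steps, each a label and the state it leads to. -/
structure Path (A : WeightedVSetAutomaton K Sig V) where
  first : A.State
  steps : List (Label Sig V × A.State)

/-- The sequence of labels of a path. -/
def Path.labels {A : WeightedVSetAutomaton K Sig V} (ρ : A.Path) : List (Label Sig V) :=
  ρ.steps.map Prod.fst

/-- From `q`, all steps are transitions of nonzero weight and the last state is accepting. -/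
def LeadsToFinal (A : WeightedVSetAutomaton K Sig V) :
    A.State → List (Label Sig V × A.State) → Prop
  | q, [] => A.finalWeight q ≠ 0
  | q, (o, p) :: l => A.transWeight q o p ≠ 0 ∧ A.LeadsToFinal p l

/-- The product of the weights of all steps from `q` on and of the final weight. -/
def stepsWeight (A : WeightedVSetAutomaton K Sig V) :
    A.State → List (Label Sig V × A.State) → K
  | q, [] => A.finalWeight q
  | q, (o, p) :: l => A.transWeight q o p * A.stepsWeight p l

/-- The weight of a run. -/
def Path.weight {A : WeightedVSetAutomaton K Sig V} (ρ : A.Path) : K :=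
  A.initialWeight ρ.first * A.stepsWeight ρ.first ρ.steps

/-- `ρ` is a run on `d`: it begins in an initial state, uses transitions of nonzero weight, ends
in an accepting state, and reads exactly `d`. -/
def IsRun (A : WeightedVSetAutomaton K Sig V) (d : List Sig) (ρ : A.Path) : Prop :=
  A.initialWeight ρ.first ≠ 0 ∧ A.LeadsToFinal ρ.first ρ.steps ∧ readWord ρ.labels = d

/-- The set of valid and nonzero runs on `d`. -/
def validRuns (A : WeightedVSetAutomaton K Sig V) (d : List Sig) : Set A.Path :=
  {ρ | A.IsRun d ρ ∧ IsValid ρ.labels ∧ ρ.weight ≠ 0}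

/-- The annotator defined by an automaton: the weight of `t` is the sum of the weights of all
valid and nonzero runs with tuple `t`. There are finitely many of them if there are no
`ε`-cycles. -/
noncomputable def annotator (A : WeightedVSetAutomaton K Sig V) : Annotator K Sig V :=
  fun d t => ∑ᶠ ρ ∈ {ρ | ρ ∈ A.validRuns d ∧ HasTuple ρ.labels t}, Path.weight ρ

end WeightedVSetAutomaton

/-- An annotator is regular if a weighted variable-set automaton without `ε`-cycles defines it. -/
def Annotator.IsRegular {K Sig Var : Type*} [CommSemiring K] {V : Finset Var}
    (S : Annotator K Sig V) : Prop :=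
  ∃ A : WeightedVSetAutomaton K Sig V, A.NoEpsCycle ∧ A.annotator = S

/-! ### String relations -/

/-- A finite union of Cartesian products of regular languages. -/
def IsRecognizable {Sig : Type*} {k : ℕ} (R : Set (Fin k → List Sig)) : Prop :=
  ∃ (n : ℕ) (L : Fin n → Fin k → Language Sig), (∀ i j, (L i j).IsRegular) ∧
    R = ⋃ i, {w | ∀ j, w j ∈ L i j}

/-- The regular `K`-annotators, with variables from `Var`, are closed under selection by `R`. -/
def IsSelectable (K Var : Type*) [CommSemiring K] {Sig : Type*} {k : ℕ}
    (R : Set (Fin k → List Sig)) : Prop :=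
  ∀ (V : Finset Var) (S : Annotator K Sig V), S.IsRegular →
    ∀ x : Fin k → V, (S.select R x).IsRegular

end KAnnotators

/-! Recognizable implies selectable over every commutative semiring. The automaton is multiplied by
a deterministic finite monitor that simulates, for each factor of each Cartesian product, a DFA on
the substring between the opening and the closing of the corresponding variable
(`annotator_withMonitor`, `foldl_substringStep`). Determinism makes runs correspond one to one with
equal weights, and acceptance depends only on the tuple, so the whole sum survives or the whole sum
vanishes.

For the converse, select from the annotator with value `1` on the concatenation of `w 0, ..., w
(k-1)`, each string marked by its own variable. The result has value `1` or `0` according to whether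
`w ∈ R`. A sum in a bipotent semiring is one of its summands, and a product equal to `1` has only
factors `1`; hence `w ∈ R` exactly when some run uses only weights `1`
(`IsBipotent.finsum_mem_eq_one_iff`, `exists_run_weight_eq_one_iff`). This is acceptance by an
unweighted finite automaton. Zero divisors, as in the Łukasiewicz semiring, do no harm because runs
of other weights are never inspected.

Nonempty strings with the same `readRelation` can be exchanged inside such a run
(`AcceptsConcat.update`). There are finitely many such relations and they compose along
concatenation, so Myhill–Nerode makes their classes regular, and `R` is a finite union of products
of classes. -/

namespace KAnnotators

/-! ### Label sequences and the positions of variable operations -/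

section Labels

variable {Sig Var : Type*} {V : Finset Var}

/-- The operation that opens (`true`) or closes (`false`) the variable `v`. -/
def Label.marker (v : V) : Bool → Label Sig V
  | true => .opening v
  | false => .closing v

open scoped Classical in
/-- The operations on `v` in a label sequence, each with the position at which it is executed when
the sequence starts at position `n`. -/
noncomputable def opEvents (v : V) : ℕ → List (Label Sig V) → List (ℕ × Bool)
  | _, [] => []
  | n, .letter _ :: o => opEvents v (n + 1) o
  | n, .eps :: o => opEvents v n o
  | n, .opening u :: o => if u = v then (n, true) :: opEvents v n o else opEvents v n o
  | n, .closing u :: o => if u = v then (n, false) :: opEvents v n o else opEvents v n o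

theorem readWord_nil : readWord ([] : List (Label Sig V)) = [] := rfl

theorem readWord_letter (a : Sig) (o : List (Label Sig V)) :
    readWord (.letter a :: o) = a :: readWord o := rfl

theorem readWord_eps (o : List (Label Sig V)) : readWord (.eps :: o) = readWord o := rfl

theorem readWord_opening (v : V) (o : List (Label Sig V)) :
    readWord (.opening v :: o) = readWord o := rfl

theorem readWord_closing (v : V) (o : List (Label Sig V)) :
    readWord (.closing v :: o) = readWord o := rfl

theorem readWord_append (o o' : List (Label Sig V)) :
    readWord (o ++ o') = readWord o ++ readWord o' :=
  List.filterMap_append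

theorem readWord_map_letter (u : List Sig) :
    readWord (u.map (Label.letter : Sig → Label Sig V)) = u := by
  induction u with
  | nil => rfl
  | cons a u ih => rw [List.map_cons, readWord_letter, ih]

theorem opEvents_append (v : V) (n : ℕ) (o o' : List (Label Sig V)) :
    opEvents v n (o ++ o') = opEvents v n o ++ opEvents v (n + (readWord o).length) o' := by
  induction o generalizing n with
  | nil => rfl
  | cons l o ih =>
    cases l with
    | letter a =>
      simp only [List.cons_append, opEvents, readWord_letter, List.length_cons, ih]
      rw [Nat.add_right_comm, Nat.add_assoc n]
    | eps => simp only [List.cons_append, opEvents, readWord_eps, ih]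
    | opening u =>
      simp only [List.cons_append, opEvents, readWord_opening, ih]
      split_ifs <;> rfl
    | closing u =>
      simp only [List.cons_append, opEvents, readWord_closing, ih]
      split_ifs <;> rfl

theorem opEvents_add (v : V) (n c : ℕ) (o : List (Label Sig V)) :
    opEvents v (n + c) o = (opEvents v n o).map fun e => (e.1 + c, e.2) := by
  induction o generalizing n with
  | nil => rfl
  | cons l o ih =>
    cases l with
    | letter a => simp only [opEvents, Nat.add_right_comm n c 1, ih]
    | eps => simp only [opEvents, ih]
    | opening u =>
      simp only [opEvents, ih]
      split_ifs <;> rfl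
    | closing u =>
      simp only [opEvents, ih]
      split_ifs <;> rfl

theorem opEvents_map_letter (v : V) (n : ℕ) (u : List Sig) :
    opEvents v n (u.map (Label.letter : Sig → Label Sig V)) = [] := by
  induction u generalizing n with
  | nil => rfl
  | cons a u ih => rw [List.map_cons, opEvents, ih]

theorem opEvents_marker_self (v : V) (n : ℕ) (b : Bool) (o : List (Label Sig V)) :
    opEvents v n (Label.marker v b :: o) = (n, b) :: opEvents v n o := by
  cases b <;> simp [Label.marker, opEvents]

theorem opEvents_eq_nil_iff (v : V) (n : ℕ) (o : List (Label Sig V)) :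
    opEvents v n o = [] ↔ ∀ b, Label.marker v b ∉ o := by
  rw [Bool.forall_bool]
  induction o generalizing n with
  | nil => simp [opEvents]
  | cons l o ih =>
    cases l with
    | letter a => simp [opEvents, ih, Label.marker]
    | eps => simp [opEvents, ih, Label.marker]
    | opening u =>
      rcases eq_or_ne u v with rfl | h
      · simp [opEvents, Label.marker]
      · simp [opEvents, ih, Label.marker, h, h.symm]
    | closing u =>
      rcases eq_or_ne u v with rfl | h
      · simp [opEvents, Label.marker]
      · simp [opEvents, ih, Label.marker, h, h.symm]

theorem opEvents_eq_nil_of_eq_nil {v : V} {n : ℕ} {o : List (Label Sig V)}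
    (h : opEvents v n o = []) (n' : ℕ) : opEvents v n' o = [] := by
  rwa [opEvents_eq_nil_iff] at h ⊢

theorem exists_of_opEvents_eq_cons {v : V} {n : ℕ} {o : List (Label Sig V)} {e : ℕ × Bool}
    {es : List (ℕ × Bool)} (h : opEvents v n o = e :: es) :
    ∃ a c, o = a ++ Label.marker v e.2 :: c ∧ opEvents v n a = [] ∧
      e.1 = n + (readWord a).length ∧ opEvents v e.1 c = es := by
  induction o generalizing n with
  | nil => simp [opEvents] at h
  | cons l o ih =>
    cases l with
    | letter s =>
      obtain ⟨a, c, rfl, ha, he, hc⟩ := ih (n := n + 1) h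
      refine ⟨.letter s :: a, c, rfl, ha, ?_, hc⟩
      rw [he, readWord_letter, List.length_cons]
      omega
    | eps =>
      obtain ⟨a, c, rfl, ha, he, hc⟩ := ih (n := n) h
      exact ⟨.eps :: a, c, rfl, ha, he, hc⟩
    | opening u =>
      by_cases huv : u = v
      · subst huv
        rw [opEvents, if_pos rfl, List.cons.injEq] at h
        obtain ⟨rfl, h⟩ := h
        exact ⟨[], o, rfl, rfl, rfl, h⟩
      · rw [opEvents, if_neg huv] at h
        obtain ⟨a, c, rfl, ha, he, hc⟩ := ih h
        exact ⟨.opening u :: a, c, rfl, by rw [opEvents, if_neg huv, ha], he, hc⟩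
    | closing u =>
      by_cases huv : u = v
      · subst huv
        rw [opEvents, if_pos rfl, List.cons.injEq] at h
        obtain ⟨rfl, h⟩ := h
        exact ⟨[], o, rfl, rfl, rfl, h⟩
      · rw [opEvents, if_neg huv] at h
        obtain ⟨a, c, rfl, ha, he, hc⟩ := ih h
        exact ⟨.closing u :: a, c, rfl, by rw [opEvents, if_neg huv, ha], he, hc⟩

/-- The variable `v` is opened exactly once and closed exactly once iff the label sequence splits
at the two operations. -/
theorem opEvents_eq_pair_iff {v : V} {o : List (Label Sig V)} {l r : ℕ} :
    opEvents v 0 o = [(l, true), (r, false)] ↔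
      ∃ a b c, o = a ++ .opening v :: (b ++ .closing v :: c) ∧
        opEvents v 0 a = [] ∧ opEvents v 0 b = [] ∧ opEvents v 0 c = [] ∧
        l = (readWord a).length ∧ r = (readWord a).length + (readWord b).length := by
  constructor
  · intro h
    obtain ⟨a, o', rfl, ha, hl, ho'⟩ := exists_of_opEvents_eq_cons h
    obtain ⟨b, c, rfl, hb, hr, hc⟩ := exists_of_opEvents_eq_cons ho'
    dsimp only at hl hr
    exact ⟨a, b, c, rfl, ha, opEvents_eq_nil_of_eq_nil hb 0, opEvents_eq_nil_of_eq_nil hc 0,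
      by omega, by omega⟩
  · rintro ⟨a, b, c, rfl, ha, hb, hc, rfl, rfl⟩
    rw [opEvents_append, ha, List.nil_append]
    change opEvents v _ (Label.marker v true :: (b ++ Label.marker v false :: c)) = _
    rw [opEvents_marker_self, opEvents_append, opEvents_eq_nil_of_eq_nil hb, List.nil_append,
      opEvents_marker_self, opEvents_eq_nil_of_eq_nil hc, Nat.zero_add]

theorem getElem?_eq_some_iff_eq_length {α : Type*} {a c : List α} {x : α} (ha : x ∉ a)
    (hc : x ∉ c) (i : ℕ) : (a ++ x :: c)[i]? = some x ↔ i = a.length := by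
  constructor
  · intro h
    rcases lt_trichotomy i a.length with hi | hi | hi
    · rw [List.getElem?_append_left hi] at h
      exact absurd (List.mem_of_getElem? h) ha
    · exact hi
    · rw [List.getElem?_append_right hi.le, List.getElem?_cons] at h
      rw [if_neg (by omega)] at h
      exact absurd (List.mem_of_getElem? h) hc
  · rintro rfl
    simp

theorem exists_append_of_getElem?_eq_some_iff {α : Type*} {o : List α} {x : α} {i : ℕ}
    (h : ∀ l, o[l]? = some x ↔ l = i) :
    ∃ a c, o = a ++ x :: c ∧ a.length = i ∧ x ∉ a ∧ x ∉ c := by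
  obtain ⟨hi, hx⟩ := List.getElem?_eq_some_iff.1 ((h i).2 rfl)
  have ho : o = o.take i ++ x :: o.drop (i + 1) := by
    rw [← hx, List.getElem_cons_drop, List.take_append_drop]
  refine ⟨o.take i, o.drop (i + 1), ho, by simp [hi.le], fun hm => ?_, fun hm => ?_⟩
  · obtain ⟨l, hl⟩ := List.mem_iff_getElem?.1 hm
    have hli : l < i := by
      by_contra hli
      rw [List.getElem?_take, if_neg hli] at hl
      cases hl
    rw [List.getElem?_take_of_lt hli, h] at hl
    omega
  · obtain ⟨l, hl⟩ := List.mem_iff_getElem?.1 hm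
    rw [List.getElem?_drop, h] at hl
    omega

/-- Turns conditions on list indices into one equation per variable. Unlike indices, `opEvents`
splits along concatenation, so all later cutting and exchanging of runs uses this form. -/
theorem isValid_and_hasTuple_iff {o : List (Label Sig V)} {d : List Sig} {t : V → Span d} :
    IsValid o ∧ HasTuple o t ↔
      ∀ v, opEvents v 0 o = [((t v).left, true), ((t v).right, false)] := by
  constructor
  · rintro ⟨hv, ht⟩ v
    obtain ⟨i, j, hij, hi, hj⟩ := hv v
    have htv := ht v i j ((hi i).2 rfl) ((hj j).2 rfl)
    obtain ⟨a, c', ho, rfl, ha, hc'⟩ := exists_append_of_getElem?_eq_some_iff hi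
    obtain ⟨a', c, ho', rfl, ha', hc⟩ := exists_append_of_getElem?_eq_some_iff hj
    have hsplit : ∃ b, a' = a ++ .opening v :: b ∧ c' = b ++ .closing v :: c := by
      rcases List.append_eq_append_iff.1 (ho.symm.trans ho') with ⟨b, hb, hb'⟩ | ⟨b, hb, -⟩
      · cases b with
        | nil => simp at hb'
        | cons x b =>
          rw [List.cons_append, List.cons.injEq] at hb'
          exact ⟨b, by rw [hb, ← hb'.1], hb'.2⟩
      · rw [hb, List.length_append] at hij
        omega
    obtain ⟨b, rfl, rfl⟩ := hsplit
    rw [opEvents_eq_pair_iff]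
    simp only [List.mem_append, List.mem_cons, not_or] at ha' hc'
    refine ⟨a, b, c, ho, ?_, ?_, ?_, ?_, ?_⟩
    · exact (opEvents_eq_nil_iff _ _ _).2 (Bool.forall_bool.2 ⟨ha'.1, ha⟩)
    · exact (opEvents_eq_nil_iff _ _ _).2 (Bool.forall_bool.2 ⟨ha'.2.2, hc'.1⟩)
    · exact (opEvents_eq_nil_iff _ _ _).2 (Bool.forall_bool.2 ⟨hc, hc'.2.2⟩)
    · rw [htv.1, position, ho, List.take_left]
    · rw [htv.2, position, ho', List.take_left, readWord_append, readWord_opening,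
        List.length_append]
  · intro h
    have key : ∀ v, ∃ i j, i < j ∧ (∀ l, o[l]? = some (Label.opening v) ↔ l = i) ∧
        (∀ l, o[l]? = some (Label.closing v) ↔ l = j) ∧
        (t v).left = position o i ∧ (t v).right = position o j := by
      intro v
      obtain ⟨a, b, c, ho, ha, hb, hc, hl, hr⟩ := opEvents_eq_pair_iff.1 (h v)
      have ho' : o = (a ++ .opening v :: b) ++ .closing v :: c := by
        rw [ho, List.append_assoc, List.cons_append]
      rw [opEvents_eq_nil_iff, Bool.forall_bool] at ha hb hc
      simp only [Label.marker] at ha hb hc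
      refine ⟨a.length, (a ++ .opening v :: b).length, by simp, fun l => ?_, fun l => ?_, ?_, ?_⟩
      · rw [ho]
        refine getElem?_eq_some_iff_eq_length ha.2 ?_ l
        simp [hb.2, hc.2]
      · rw [ho']
        refine getElem?_eq_some_iff_eq_length ?_ hc.1 l
        simp [ha.1, hb.1]
      · rw [hl, position, ho, List.take_left]
      · rw [hr, position, ho', List.take_left, readWord_append, readWord_opening,
          List.length_append]
    refine ⟨fun v => ?_, fun v i j hi hj => ?_⟩
    · obtain ⟨i, j, hij, hi, hj, -⟩ := key v
      exact ⟨i, j, hij, hi, hj⟩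
    · obtain ⟨i', j', -, hi', hj', hl, hr⟩ := key v
      rw [(hi' i).1 hi, (hj' j).1 hj]
      exact ⟨hl, hr⟩

open scoped Classical in
/-- The labels other than `ε` are the letters and the operations on the variables. -/
theorem countP_ne_eps_eq (n : ℕ) (o : List (Label Sig V)) :
    o.countP (fun l => l ≠ Label.eps) =
      (readWord o).length + ∑ v : V, (opEvents v n o).length := by
  induction o generalizing n with
  | nil => simp [readWord_nil, opEvents]
  | cons l o ih =>
    cases l with
    | letter a =>
      rw [List.countP_cons_of_pos (by simp), ih (n + 1), readWord_letter, List.length_cons]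
      simp only [opEvents]
      omega
    | eps =>
      rw [List.countP_cons_of_neg (by simp), ih n]
      rfl
    | opening u =>
      rw [List.countP_cons_of_pos (by simp), ih n, readWord_opening, Nat.add_assoc]
      congr 1
      simp only [opEvents, apply_ite List.length, List.length_cons]
      rw [← Finset.add_sum_erase _ _ (Finset.mem_univ u),
        ← Finset.add_sum_erase _ _ (Finset.mem_univ u), if_pos rfl, Nat.add_right_comm]
      congr 1
      exact Finset.sum_congr rfl fun v hv => by rw [if_neg (Finset.ne_of_mem_erase hv).symm]
    | closing u =>
      rw [List.countP_cons_of_pos (by simp), ih n, readWord_closing, Nat.add_assoc]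
      congr 1
      simp only [opEvents, apply_ite List.length, List.length_cons]
      rw [← Finset.add_sum_erase _ _ (Finset.mem_univ u),
        ← Finset.add_sum_erase _ _ (Finset.mem_univ u), if_pos rfl, Nat.add_right_comm]
      congr 1
      exact Finset.sum_congr rfl fun v hv => by rw [if_neg (Finset.ne_of_mem_erase hv).symm]

instance [Finite Sig] : Finite (Label Sig V) :=
  Finite.of_injective
    (fun l : Label Sig V => match l with
      | .letter a => (Sum.inl (some a) : Option Sig ⊕ (V × Bool))
      | .eps => Sum.inl none
      | .opening v => Sum.inr (v, true)
      | .closing v => Sum.inr (v, false))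
    (fun l l' h => by cases l <;> cases l' <;> simp_all)

end Labels

namespace WeightedVSetAutomaton

variable {K Sig Var : Type*} [CommSemiring K] {V : Finset Var}

omit [CommSemiring K] in
theorem Path.labels_mk {A : WeightedVSetAutomaton K Sig V} (q : A.State)
    (l : List (Label Sig V × A.State)) : (Path.mk q l).labels = l.map Prod.fst := rfl

theorem Path.weight_mk {A : WeightedVSetAutomaton K Sig V} (q : A.State)
    (l : List (Label Sig V × A.State)) :
    (Path.mk q l).weight = A.initialWeight q * A.stepsWeight q l := rfl

/-! ### Finiteness of the set of runs -/

section Finiteness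

/-- Without `ε`-cycles, reversed `ε`-transitions are well-founded. -/
theorem NoEpsCycle.wellFounded {A : WeightedVSetAutomaton K Sig V} (hA : A.NoEpsCycle) :
    WellFounded (fun p' p : A.State => A.transWeight p Label.eps p' ≠ 0) := by
  have := A.finite_state
  let r : A.State → A.State → Prop :=
    Relation.TransGen fun p' p : A.State => A.transWeight p Label.eps p' ≠ 0
  have : Std.Irrefl r := ⟨fun q hq => hA q (Relation.transGen_swap.1 hq)⟩
  have : IsTrans A.State r := ⟨fun _ _ _ => Relation.TransGen.trans⟩
  have hr : WellFounded r := Finite.wellFounded_of_trans_of_irrefl r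
  exact Subrelation.wf (r := r) (fun h => Relation.TransGen.single h) hr

open scoped Classical in
/-- Without `ε`-cycles, there are finitely many ways to reach acceptance by a bounded number of
transitions not labelled `ε`. -/
theorem NoEpsCycle.finite_steps [Finite Sig] {A : WeightedVSetAutomaton K Sig V}
    (hA : A.NoEpsCycle) (n : ℕ) (q : A.State) :
    {l | A.LeadsToFinal q l ∧ (l.map Prod.fst).countP (fun o => o ≠ Label.eps) ≤ n}.Finite := by
  have := A.finite_state
  induction n using Nat.strong_induction_on generalizing q with
  | _ n ihn =>
  induction q using hA.wellFounded.induction with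
  | _ q ihq =>
  -- The induction is lexicographic in the bound `n` and the state: an `ε`-step keeps `n` but
  -- descends in the well-founded order, any other step lowers `n`. `T s` collects the continuations
  -- after a first step `s`.
  let T : Label Sig V × A.State → Set (List (Label Sig V × A.State)) := fun s =>
    {l | A.LeadsToFinal q (s :: l) ∧
      ((s :: l).map Prod.fst).countP (fun o => o ≠ Label.eps) ≤ n}
  have hT : ∀ s, (T s).Finite := by
    rintro ⟨o, p⟩
    by_cases hw : A.transWeight q o p = 0
    · convert Set.finite_empty
      ext l
      simp [T, LeadsToFinal, hw]
    · by_cases ho : o = Label.eps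
      · subst ho
        refine (ihq p hw).subset fun l hl => ⟨hl.1.2, ?_⟩
        have := hl.2
        rwa [List.map_cons, List.countP_cons_of_neg (by simp)] at this
      · cases n with
        | zero =>
          convert Set.finite_empty
          ext l
          simp [T, ho]
        | succ n =>
          refine (ihn n (Nat.lt_succ_self n) p).subset fun l hl => ⟨hl.1.2, ?_⟩
          have := hl.2
          rw [List.map_cons, List.countP_cons_of_pos (by simpa using ho)] at this
          omega
  refine ((Set.finite_singleton []).union
    (Set.finite_iUnion fun s => (hT s).image (List.cons s))).subset ?_
  rintro (_ | ⟨s, l⟩) hl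
  · exact Or.inl rfl
  · exact Or.inr (Set.mem_iUnion.2 ⟨s, l, hl, rfl⟩)

/-- This makes `finsum` an honest sum in `annotator`: over an infinite support it would silently be
`0`. -/
theorem NoEpsCycle.finite_validRuns [Finite Sig] {A : WeightedVSetAutomaton K Sig V}
    (hA : A.NoEpsCycle) (d : List Sig) (t : V → Span d) :
    {ρ | ρ ∈ A.validRuns d ∧ HasTuple ρ.labels t}.Finite := by
  classical
  have := A.finite_state
  -- A valid run has one label per letter of `d` and two operations per variable, apart from its
  -- `ε`-steps.
  refine (Set.finite_iUnion fun q => (hA.finite_steps (d.length + ∑ _v : V, 2) q).image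
    (Path.mk q)).subset ?_
  rintro ⟨q, l⟩ ⟨⟨⟨-, hl, hd⟩, hv, -⟩, ht⟩
  refine Set.mem_iUnion.2 ⟨q, l, ⟨hl, ?_⟩, rfl⟩
  have h := isValid_and_hasTuple_iff.1 ⟨hv, ht⟩
  rw [Path.labels_mk] at h hd
  rw [countP_ne_eps_eq 0, hd]
  simp [h]

end Finiteness

/-! ### Product with a deterministic monitor -/

section Monitor

/-- The product of an automaton with a deterministic finite monitor on its label sequences. -/
noncomputable def withMonitor (A : WeightedVSetAutomaton K Sig V) {M : Type} (hM : Finite M)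
    (start : M) (step : M → Label Sig V → M) (acc : Set M) : WeightedVSetAutomaton K Sig V :=
  open scoped Classical in
  { State := A.State × M
    finite_state := by
      have := A.finite_state
      infer_instance
    initialWeight := fun s => if s.2 = start then A.initialWeight s.1 else 0
    finalWeight := fun s => if s.2 ∈ acc then A.finalWeight s.1 else 0
    transWeight := fun s o s' => if s'.2 = step s.2 o then A.transWeight s.1 o s'.1 else 0 }

variable {A : WeightedVSetAutomaton K Sig V} {M : Type} (hM : Finite M)
    (start : M) (step : M → Label Sig V → M) (acc : Set M)

/-- The steps of the product automaton over given steps of `A`. -/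
def liftSteps (A : WeightedVSetAutomaton K Sig V) {M : Type} (step : M → Label Sig V → M) :
    M → List (Label Sig V × A.State) → List (Label Sig V × (A.State × M))
  | _, [] => []
  | m, (o, p) :: l => (o, (p, step m o)) :: liftSteps A step (step m o) l

omit [CommSemiring K] in
theorem map_fst_liftSteps (m : M) (l : List (Label Sig V × A.State)) :
    (liftSteps A step m l).map Prod.fst = l.map Prod.fst := by
  induction l generalizing m with
  | nil => rfl
  | cons s l ih => rw [liftSteps, List.map_cons, List.map_cons, ih]

omit [CommSemiring K] in
theorem liftSteps_injective (m : M) : Function.Injective (liftSteps A step m) := by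
  intro l l' h
  induction l generalizing m l' with
  | nil =>
    cases l' with
    | nil => rfl
    | cons s l' => simp [liftSteps] at h
  | cons s l ih =>
    cases l' with
    | nil => simp [liftSteps] at h
    | cons s' l' =>
      obtain ⟨o, p⟩ := s
      obtain ⟨o', p'⟩ := s'
      simp only [liftSteps, List.cons.injEq, Prod.mk.injEq] at h
      obtain ⟨⟨rfl, rfl, -⟩, h⟩ := h
      rw [ih _ h]

theorem leadsToFinal_liftSteps (q : A.State) (m : M) (l : List (Label Sig V × A.State)) :
    (A.withMonitor hM start step acc).LeadsToFinal (q, m) (liftSteps A step m l) ↔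
      A.LeadsToFinal q l ∧ (l.map Prod.fst).foldl step m ∈ acc := by
  induction l generalizing q m with
  | nil => simp [liftSteps, LeadsToFinal, withMonitor, and_comm]
  | cons s l ih =>
    simp only [liftSteps, LeadsToFinal, ih, List.map_cons, List.foldl_cons, and_assoc]
    simp [withMonitor]

/-- Nonzero weight forces each monitor state to be the one computed by `step`, so the second
component carries no choice. -/
theorem exists_eq_liftSteps {q : A.State} {m : M} {l : List (Label Sig V × (A.State × M))}
    (h : (A.withMonitor hM start step acc).LeadsToFinal (q, m) l) :
    ∃ l', l = liftSteps A step m l' := by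
  induction l generalizing q m with
  | nil => exact ⟨[], rfl⟩
  | cons s l ih =>
    obtain ⟨o, p, m'⟩ := s
    obtain ⟨hw, hl⟩ := h
    have hm : m' = step m o := by
      by_contra hm
      exact hw (if_neg hm)
    subst hm
    obtain ⟨l', rfl⟩ := ih hl
    exact ⟨(o, p) :: l', rfl⟩

theorem stepsWeight_liftSteps (q : A.State) (m : M) (l : List (Label Sig V × A.State))
    (h : (l.map Prod.fst).foldl step m ∈ acc) :
    (A.withMonitor hM start step acc).stepsWeight (q, m) (liftSteps A step m l) =
      A.stepsWeight q l := by
  induction l generalizing q m with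
  | nil => exact if_pos h
  | cons s l ih =>
    simp only [liftSteps, stepsWeight]
    rw [ih _ _ h]
    simp [withMonitor]

theorem NoEpsCycle.withMonitor (hA : A.NoEpsCycle) :
    (A.withMonitor hM start step acc).NoEpsCycle := by
  intro s hs
  refine hA s.1 (Relation.TransGen.lift Prod.fst (fun p p' hw hw' => hw ?_) s s hs)
  simp [WeightedVSetAutomaton.withMonitor, hw']

/-- The run of the product automaton over a run of `A`. -/
def liftPath (ρ : A.Path) : (A.withMonitor hM start step acc).Path :=
  ⟨(ρ.first, start), liftSteps A step start ρ.steps⟩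

theorem labels_liftPath (ρ : A.Path) :
    (liftPath hM start step acc ρ).labels = ρ.labels :=
  map_fst_liftSteps step start ρ.steps

theorem weight_liftPath {ρ : A.Path} (h : ρ.labels.foldl step start ∈ acc) :
    (liftPath hM start step acc ρ).weight = ρ.weight :=
  congrArg₂ (· * ·) (if_pos rfl) (stepsWeight_liftSteps hM start step acc ρ.first start ρ.steps h)

theorem isRun_liftPath_iff {d : List Sig} {ρ : A.Path} :
    (A.withMonitor hM start step acc).IsRun d (liftPath hM start step acc ρ) ↔
      A.IsRun d ρ ∧ ρ.labels.foldl step start ∈ acc := by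
  have hi : (A.withMonitor hM start step acc).initialWeight (liftPath hM start step acc ρ).first =
      A.initialWeight ρ.first := if_pos rfl
  have hl := leadsToFinal_liftSteps hM start step acc ρ.first start ρ.steps
  rw [IsRun, IsRun, labels_liftPath, hi]
  exact ⟨fun h => ⟨⟨h.1, (hl.1 h.2.1).1, h.2.2⟩, (hl.1 h.2.1).2⟩,
    fun h => ⟨h.1.1, hl.2 ⟨h.1.2.1, h.2⟩, h.1.2.2⟩⟩

theorem liftPath_injective : Function.Injective (liftPath (A := A) hM start step acc) := by
  rintro ⟨q, l⟩ ⟨q', l'⟩ h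
  have hq : q = q' := congrArg Prod.fst (congrArg Path.first h)
  have hl : l = l' := liftSteps_injective step start (congrArg Path.steps h)
  rw [hq, hl]

theorem IsRun.exists_eq_liftPath {d : List Sig} {ρ : (A.withMonitor hM start step acc).Path}
    (h : (A.withMonitor hM start step acc).IsRun d ρ) :
    ∃ ρ', ρ = liftPath hM start step acc ρ' := by
  obtain ⟨⟨q, m⟩, l⟩ := ρ
  have hm : m = start := by
    by_contra hm
    exact h.1 (if_neg hm)
  subst hm
  obtain ⟨l, rfl⟩ := exists_eq_liftSteps hM m step acc h.2.1
  exact ⟨⟨q, l⟩, rfl⟩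

/-- The monitored automaton sums over the runs that the monitor accepts. -/
theorem annotator_withMonitor (d : List Sig) (t : V → Span d) :
    (A.withMonitor hM start step acc).annotator d t =
      ∑ᶠ ρ ∈ {ρ | (ρ ∈ A.validRuns d ∧ HasTuple ρ.labels t) ∧
        ρ.labels.foldl step start ∈ acc}, Path.weight ρ := by
  symm
  refine finsum_mem_eq_of_bijOn (liftPath hM start step acc) ⟨?_, ?_, ?_⟩ ?_
  · rintro ρ ⟨⟨⟨hρ, hv, hw⟩, ht⟩, hacc⟩
    refine ⟨⟨(isRun_liftPath_iff hM start step acc).2 ⟨hρ, hacc⟩, ?_, ?_⟩, ?_⟩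
    · rwa [labels_liftPath]
    · rwa [weight_liftPath hM start step acc hacc]
    · rwa [labels_liftPath]
  · exact (liftPath_injective hM start step acc).injOn
  · rintro ρ ⟨⟨hρ, hv, hw⟩, ht⟩
    obtain ⟨ρ, rfl⟩ := hρ.exists_eq_liftPath
    obtain ⟨hρ, hacc⟩ := (isRun_liftPath_iff hM start step acc).1 hρ
    rw [weight_liftPath hM start step acc hacc] at hw
    rw [labels_liftPath] at hv ht
    exact ⟨ρ, ⟨⟨⟨hρ, hv, hw⟩, ht⟩, hacc⟩, rfl⟩
  · exact fun ρ hρ => (weight_liftPath hM start step acc hρ.2).symm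

end Monitor

end WeightedVSetAutomaton

/-! ### Selection by recognizable relations -/

section Selection

variable {K Sig Var : Type*} [CommSemiring K] {V : Finset Var}

open scoped Classical in
/-- Runs a DFA on the part of the document between the opening and the closing of `v`. The flag
says whether `v` is open. -/
noncomputable def substringStep {σ : Type*} (D : DFA Sig σ) (v : V) :
    Bool × σ → Label Sig V → Bool × σ
  | (b, s), .letter a => (b, if b then D.step s a else s)
  | m, .eps => m
  | (b, s), .opening u => (if u = v then true else b, s)
  | (b, s), .closing u => (if u = v then false else b, s)

/-- Between operations on `v` the flag is constant, so the DFA either reads every letter or stays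
put. -/
theorem foldl_substringStep_of_opEvents_eq_nil {σ : Type*} (D : DFA Sig σ) {v : V}
    {n : ℕ} {o : List (Label Sig V)} (h : opEvents v n o = []) (b : Bool) (s : σ) :
    o.foldl (substringStep D v) (b, s) = (b, if b then D.evalFrom s (readWord o) else s) := by
  induction o generalizing n s with
  | nil => simp [readWord_nil]
  | cons l o ih =>
    rw [List.foldl_cons]
    cases l with
    | letter a =>
      rw [substringStep, ih (n := n + 1) h, readWord_letter, DFA.evalFrom_cons]
      cases b <;> rfl
    | eps => exact ih h s
    | opening u =>
      by_cases hu : u = v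
      · simp [opEvents, hu] at h
      · rw [opEvents, if_neg hu] at h
        rw [substringStep, if_neg hu, ih h, readWord_opening]
    | closing u =>
      by_cases hu : u = v
      · simp [opEvents, hu] at h
      · rw [opEvents, if_neg hu] at h
        rw [substringStep, if_neg hu, ih h, readWord_closing]

theorem foldl_substringStep {σ : Type*} (D : DFA Sig σ) {d : List Sig} {t : V → Span d}
    {o : List (Label Sig V)} (hd : readWord o = d) (hv : IsValid o) (ht : HasTuple o t) (v : V) :
    o.foldl (substringStep D v) (false, D.start) = (false, D.eval (t v).substring) := by
  obtain ⟨a, b, c, rfl, ha, hb, hc, hl, hr⟩ :=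
    opEvents_eq_pair_iff.1 (isValid_and_hasTuple_iff.1 ⟨hv, ht⟩ v)
  have hsub : (t v).substring = readWord b := by
    subst hd
    rw [Span.substring, hl, hr, readWord_append, readWord_opening, readWord_append,
      List.drop_left, Nat.add_sub_cancel_left, List.take_left]
  simp only [List.foldl_append, List.foldl_cons]
  rw [foldl_substringStep_of_opEvents_eq_nil D ha]
  simp only [substringStep, if_true, Bool.false_eq_true, if_false]
  rw [foldl_substringStep_of_opEvents_eq_nil D hb]
  simp only [if_true]
  rw [foldl_substringStep_of_opEvents_eq_nil D hc, hsub]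
  simp [DFA.eval]

theorem foldl_pi {α : Type*} {ι : Type*} {β : ι → Type*} (f : ∀ i, β i → α → β i)
    (b : ∀ i, β i) (l : List α) :
    l.foldl (fun b a i => f i (b i) a) b = fun i => l.foldl (f i) (b i) := by
  induction l generalizing b with
  | nil => rfl
  | cons a l ih => rw [List.foldl_cons, ih]; rfl

/-- Regular annotators over any commutative semiring are closed under selection by recognizable
relations. -/
theorem IsRecognizable.isSelectable {k : ℕ} {R : Set (Fin k → List Sig)}
    (hR : IsRecognizable R) : IsSelectable K Var R := by
  obtain ⟨n, L, hL, rfl⟩ := hR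
  intro V S ⟨A, hA, hS⟩ x
  subst hS
  choose σ hσ D hD using hL
  -- All `n * k` DFAs run in parallel in one monitor. Separate automata for the `n` products would
  -- count a run several times when the products overlap.
  let M : Type := ∀ ij : Fin n × Fin k, Bool × σ ij.1 ij.2
  have hM : Finite M := by
    have := hσ
    infer_instance
  let f : ∀ ij : Fin n × Fin k, Bool × σ ij.1 ij.2 → Label Sig V → Bool × σ ij.1 ij.2 :=
    fun ij => substringStep (D ij.1 ij.2) (x ij.2)
  let start : M := fun ij => (false, (D ij.1 ij.2).start)
  let step : M → Label Sig V → M := fun m a ij => f ij (m ij) a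
  let acc : Set M := {m | ∃ i, ∀ j, (m (i, j)).2 ∈ (D i j).accept}
  refine ⟨A.withMonitor hM start step acc, hA.withMonitor hM start step acc, ?_⟩
  funext d t
  rw [WeightedVSetAutomaton.annotator_withMonitor, Annotator.select]
  have key : ∀ o : List (Label Sig V), readWord o = d → IsValid o → HasTuple o t →
      (o.foldl step start ∈ acc ↔
        (fun j => (t (x j)).substring) ∈ ⋃ i, {w : Fin k → List Sig | ∀ j, w j ∈ L i j}) := by
    intro o hd hv ht
    have hfold : o.foldl step start = fun ij => o.foldl (f ij) (start ij) := foldl_pi f start o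
    rw [Set.mem_iUnion, hfold]
    refine exists_congr fun i => forall_congr' fun j => ?_
    rw [← hD i j, DFA.mem_accepts]
    simp only [f, start]
    rw [foldl_substringStep (D i j) hd hv ht (x j)]
  -- The condition `h` concerns `t` alone, so the monitor accepts all runs with tuple `t` or none of
  -- them.
  split_ifs with h
  · rw [mul_one, WeightedVSetAutomaton.annotator]
    refine finsum_mem_congr (Set.ext fun ρ => ⟨fun hρ => hρ.1, fun hρ => ⟨hρ, ?_⟩⟩) fun _ _ => rfl
    exact (key _ hρ.1.1.2.2 hρ.1.2.1 hρ.2).2 h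
  · rw [mul_zero]
    convert finsum_mem_empty
    refine Set.eq_empty_iff_forall_notMem.2 fun ρ hρ => h ?_
    exact (key _ hρ.1.1.1.2.2 hρ.1.1.2.1 hρ.1.2).1 hρ.2

end Selection

/-! ### Sums in bipotent semirings -/

section Bipotent

variable {K : Type*} [CommSemiring K]

theorem IsBipotent.add_self (hK : IsBipotent K) (a : K) : a + a = a :=
  (hK a a).elim id id

theorem IsBipotent.eq_zero_of_add_eq_zero (hK : IsBipotent K) {a b : K} (h : a + b = 0) :
    a = 0 := by
  rw [← add_zero a, ← h, ← add_assoc, hK.add_self]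

/-- By bipotence a finite sum is `0` or one of its summands. The assumption `h01` serves the other
direction: a summand `1` might be absorbed by another element, but it cannot vanish, since
idempotent addition leaves no nonzero element an additive inverse. -/
theorem IsBipotent.finsum_mem_eq_one_iff (hK : IsBipotent K) [Nontrivial K] {α : Type*}
    {s : Set α} (hs : s.Finite) {f : α → K} (h01 : ∑ᶠ i ∈ s, f i = 0 ∨ ∑ᶠ i ∈ s, f i = 1) :
    ∑ᶠ i ∈ s, f i = 1 ↔ ∃ i ∈ s, f i = 1 := by
  classical
  constructor
  · rw [finsum_mem_eq_finite_toFinset_sum f hs]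
    intro h
    have key : ∀ u : Finset α, ∑ i ∈ u, f i = 0 ∨ ∃ i ∈ u, ∑ i ∈ u, f i = f i := by
      intro u
      induction u using Finset.induction_on with
      | empty => exact Or.inl rfl
      | insert a u ha ih =>
        rw [Finset.sum_insert ha]
        rcases hK (f a) (∑ i ∈ u, f i) with h | h
        · exact Or.inr ⟨a, Finset.mem_insert_self _ _, h⟩
        · rw [h]
          exact ih.imp_right fun ⟨i, hi, hi'⟩ => ⟨i, Finset.mem_insert_of_mem hi, hi'⟩
    rcases key hs.toFinset with h0 | ⟨i, hi, hi'⟩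
    · exact absurd (h0.symm.trans h) zero_ne_one
    · exact ⟨i, hs.mem_toFinset.1 hi, hi'.symm.trans h⟩
  · rintro ⟨i, hi, hi'⟩
    refine h01.resolve_left fun h0 => ?_
    rw [finsum_mem_eq_finite_toFinset_sum f hs,
      ← Finset.add_sum_erase _ _ (hs.mem_toFinset.2 hi)] at h0
    exact one_ne_zero (hi'.symm.trans (hK.eq_zero_of_add_eq_zero h0))

end Bipotent

/-! ### Runs of weight one as unweighted walks -/

namespace WeightedVSetAutomaton

variable {K Sig Var : Type*} [CommSemiring K] {V : Finset Var}

/-- There is a path from `p` to `q` with the given labels all of whose transitions have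
weight `1`. -/
def UnitWalk (A : WeightedVSetAutomaton K Sig V) :
    A.State → List (Label Sig V) → A.State → Prop
  | p, [], q => p = q
  | p, l :: o, q => ∃ r, A.transWeight p l r = 1 ∧ A.UnitWalk r o q

variable {A : WeightedVSetAutomaton K Sig V}

theorem unitWalk_append {p q : A.State} {o o' : List (Label Sig V)} :
    A.UnitWalk p (o ++ o') q ↔ ∃ r, A.UnitWalk p o r ∧ A.UnitWalk r o' q := by
  induction o generalizing p with
  | nil => simp [UnitWalk]
  | cons l o ih =>
    simp only [List.cons_append, UnitWalk, ih]
    constructor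
    · rintro ⟨s, hs, r, hr, hr'⟩
      exact ⟨r, ⟨s, hs, hr⟩, hr'⟩
    · rintro ⟨r, ⟨s, hs, hr⟩, hr'⟩
      exact ⟨s, hs, r, hr, hr'⟩

theorem exists_unitWalk_of_stepsWeight_eq_one (hK : ∀ a b : K, a * b = 1 → a = 1 ∧ b = 1)
    {p : A.State} {l : List (Label Sig V × A.State)} (h : A.stepsWeight p l = 1) :
    ∃ q, A.UnitWalk p (l.map Prod.fst) q ∧ A.finalWeight q = 1 := by
  induction l generalizing p with
  | nil => exact ⟨p, rfl, h⟩
  | cons s l ih =>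
    obtain ⟨h1, h2⟩ := hK _ _ h
    obtain ⟨q, hq, hq'⟩ := ih h2
    exact ⟨q, ⟨s.2, h1, hq⟩, hq'⟩

theorem UnitWalk.exists_steps [Nontrivial K] {p q : A.State} {o : List (Label Sig V)}
    (h : A.UnitWalk p o q) (hq : A.finalWeight q = 1) :
    ∃ l, l.map Prod.fst = o ∧ A.LeadsToFinal p l ∧ A.stepsWeight p l = 1 := by
  induction o generalizing p with
  | nil =>
    obtain rfl : p = q := h
    exact ⟨[], rfl, by rw [LeadsToFinal, hq]; exact one_ne_zero, hq⟩
  | cons a o ih =>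
    obtain ⟨r, hr, h⟩ := h
    obtain ⟨l, rfl, hl, hl'⟩ := ih h
    exact ⟨(a, r) :: l, rfl, ⟨by rw [hr]; exact one_ne_zero, hl⟩,
      by rw [stepsWeight, hr, hl', one_mul]⟩

/-- The runs of weight `1` are the accepting walks along weights `1`. -/
theorem exists_run_weight_eq_one_iff [Nontrivial K]
    (hK : ∀ a b : K, a * b = 1 → a = 1 ∧ b = 1) (d : List Sig) (t : V → Span d) :
    (∃ ρ ∈ {ρ | ρ ∈ A.validRuns d ∧ HasTuple ρ.labels t}, ρ.weight = 1) ↔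
      ∃ o, readWord o = d ∧ (∀ v, opEvents v 0 o = [((t v).left, true), ((t v).right, false)]) ∧
        ∃ p q, A.initialWeight p = 1 ∧ A.UnitWalk p o q ∧ A.finalWeight q = 1 := by
  constructor
  · rintro ⟨⟨p, l⟩, ⟨⟨⟨-, -, hd⟩, hv, -⟩, ht⟩, hw⟩
    obtain ⟨hp, hl⟩ := hK _ _ hw
    obtain ⟨q, hq, hq'⟩ := exists_unitWalk_of_stepsWeight_eq_one hK hl
    exact ⟨_, hd, isValid_and_hasTuple_iff.1 ⟨hv, ht⟩, p, q, hp, hq, hq'⟩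
  · rintro ⟨o, hd, he, p, q, hp, ho, hq⟩
    obtain ⟨l, rfl, hl, hl'⟩ := ho.exists_steps hq
    obtain ⟨hv, ht⟩ := isValid_and_hasTuple_iff.2 he
    have hw : (Path.mk p l).weight = 1 := by rw [Path.weight_mk, hp, hl', one_mul]
    exact ⟨⟨p, l⟩, ⟨⟨⟨by rw [hp]; exact one_ne_zero, hl, hd⟩, hv, by
      rw [hw]; exact one_ne_zero⟩, ht⟩, hw⟩

open scoped Classical in
/-- The one-state automaton in which all runs without `ε`-transitions have weight `1`. -/
noncomputable def unitAutomaton (K Sig : Type*) [CommSemiring K] {Var : Type*} (V : Finset Var) :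
    WeightedVSetAutomaton K Sig V where
  State := Unit
  finite_state := inferInstance
  initialWeight := fun _ => 1
  finalWeight := fun _ => 1
  transWeight := fun _ l _ => if l = Label.eps then 0 else 1

theorem unitAutomaton_noEpsCycle : (unitAutomaton K Sig V).NoEpsCycle := by
  intro q hq
  obtain ⟨p, hp, -⟩ := Relation.TransGen.head'_iff.1 hq
  exact hp (if_pos rfl)

theorem stepsWeight_unitAutomaton {q : (unitAutomaton K Sig V).State}
    {l : List (Label Sig V × (unitAutomaton K Sig V).State)}
    (h : (unitAutomaton K Sig V).LeadsToFinal q l) :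
    (unitAutomaton K Sig V).stepsWeight q l = 1 := by
  induction l generalizing q with
  | nil => rfl
  | cons s l ih =>
    have hs : s.1 ≠ Label.eps := fun hs => h.1 (if_pos hs)
    rw [stepsWeight, ih h.2, mul_one]
    exact if_neg hs

theorem unitWalk_unitAutomaton {q q' : (unitAutomaton K Sig V).State} {o : List (Label Sig V)}
    (h : Label.eps ∉ o) : (unitAutomaton K Sig V).UnitWalk q o q' := by
  induction o with
  | nil => exact Subsingleton.elim (α := Unit) q q'
  | cons l o ih =>
    rw [List.mem_cons, not_or] at h
    exact ⟨q, if_neg (Ne.symm h.1), ih h.2⟩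

/-- Every summand is `1` and `1 + 1 = 1`; the sequence `o` only witnesses that the sum is not empty.
-/
theorem annotator_unitAutomaton [Finite Sig] [Nontrivial K] (hK : IsBipotent K)
    (hK' : ∀ a b : K, a * b = 1 → a = 1 ∧ b = 1) {d : List Sig} {t : V → Span d}
    {o : List (Label Sig V)} (hd : readWord o = d)
    (ho : ∀ v, opEvents v 0 o = [((t v).left, true), ((t v).right, false)])
    (heps : Label.eps ∉ o) : (unitAutomaton K Sig V).annotator d t = 1 := by
  have hfin := (unitAutomaton_noEpsCycle (K := K)).finite_validRuns d t
  obtain ⟨ρ, hρ, -⟩ := (exists_run_weight_eq_one_iff hK' d t).2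
    ⟨o, hd, ho, (), (), rfl, unitWalk_unitAutomaton (K := K) heps, rfl⟩
  rw [annotator, finsum_mem_eq_finite_toFinset_sum _ hfin]
  refine Finset.sum_induction_nonempty _ (· = 1) ?_ ⟨ρ, hfin.mem_toFinset.2 hρ⟩ ?_
  · rintro a b rfl rfl
    exact hK.add_self 1
  · intro ρ hρ
    have hl := (hfin.mem_toFinset.1 hρ).1.1.2.1
    rw [Path.weight, stepsWeight_unitAutomaton hl, mul_one]
    rfl

/-- The pairs of states that `A` connects by weights `1` while it reads `u` without opening or
closing a variable. -/
def readRelation (A : WeightedVSetAutomaton K Sig V) (u : List Sig) : Set (A.State × A.State) :=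
  {s | ∃ m, readWord m = u ∧ (∀ v, opEvents v 0 m = []) ∧ A.UnitWalk s.1 m s.2}

/-- Reading a concatenation composes the relations, so equality of `readRelation` is a congruence,
of finite index because the states are finite in number. -/
theorem mem_readRelation_append {u u' : List Sig} {s : A.State × A.State} :
    s ∈ A.readRelation (u ++ u') ↔
      ∃ r, (s.1, r) ∈ A.readRelation u ∧ (r, s.2) ∈ A.readRelation u' := by
  constructor
  · rintro ⟨m, hm, he, hw⟩
    obtain ⟨m₁, m₂, rfl, h₁, h₂⟩ := List.filterMap_eq_append_iff.1 hm
    obtain ⟨r, hr₁, hr₂⟩ := unitWalk_append.1 hw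
    simp only [opEvents_append, List.append_eq_nil_iff] at he
    exact ⟨r, ⟨m₁, h₁, fun v => (he v).1, hr₁⟩,
      ⟨m₂, h₂, fun v => opEvents_eq_nil_of_eq_nil (he v).2 0, hr₂⟩⟩
  · rintro ⟨r, ⟨m₁, h₁, he₁, hr₁⟩, ⟨m₂, h₂, he₂, hr₂⟩⟩
    refine ⟨m₁ ++ m₂, by rw [readWord_append, h₁, h₂], fun v => ?_,
      unitWalk_append.2 ⟨r, hr₁, hr₂⟩⟩
    rw [opEvents_append, he₁, opEvents_eq_nil_of_eq_nil (he₂ v), List.append_nil]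

end WeightedVSetAutomaton

/-! ### Exchanging a factor of the document in a run -/

section Substitution

variable {Sig Var : Type*} {V : Finset Var}

theorem bounds_of_mem_opEvents {v : V} {n : ℕ} {o : List (Label Sig V)} {e : ℕ × Bool}
    (h : e ∈ opEvents v n o) : n ≤ e.1 ∧ e.1 ≤ n + (readWord o).length := by
  induction o generalizing n with
  | nil => simp [opEvents] at h
  | cons l o ih =>
    cases l with
    | letter a =>
      have := ih (n := n + 1) h
      rw [readWord_letter, List.length_cons]
      omega
    | eps => exact ih h
    | opening u =>
      rw [opEvents] at h
      split_ifs at h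
      · rcases List.mem_cons.1 h with rfl | h
        · exact ⟨le_rfl, Nat.le_add_right _ _⟩
        · exact ih h
      · exact ih h
    | closing u =>
      rw [opEvents] at h
      split_ifs at h
      · rcases List.mem_cons.1 h with rfl | h
        · exact ⟨le_rfl, Nat.le_add_right _ _⟩
        · exact ih h
      · exact ih h

theorem exists_append_of_readWord_eq_cons {o : List (Label Sig V)} {a : Sig} {u : List Sig}
    (h : readWord o = a :: u) :
    ∃ o₁ o₂, o = o₁ ++ .letter a :: o₂ ∧ readWord o₁ = [] ∧ readWord o₂ = u := by
  obtain ⟨o₁, l, o₂, rfl, h₁, hl, h₂⟩ := List.filterMap_eq_cons_iff.1 h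
  cases l with
  | letter b =>
    obtain rfl : b = a := Option.some.inj hl
    exact ⟨o₁, o₂, rfl, List.filterMap_eq_nil_iff.2 h₁, h₂⟩
  | eps => cases hl
  | opening v => cases hl
  | closing v => cases hl

/-- The cut is made as early as possible, right after the last letter of `u`; operations executed at
the end of `u` therefore fall into `o'`. -/
theorem exists_append_of_readWord_eq_append {o : List (Label Sig V)} {u u' : List Sig}
    (h : readWord o = u ++ u') :
    ∃ m o', o = m ++ o' ∧ readWord m = u ∧ readWord o' = u' ∧
      ∀ v n, ∀ e ∈ opEvents v n m, e.1 < n + u.length := by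
  induction u generalizing o with
  | nil => exact ⟨[], o, rfl, rfl, h, by simp [opEvents]⟩
  | cons a u ih =>
    obtain ⟨o₁, o₂, rfl, h₁, h₂⟩ := exists_append_of_readWord_eq_cons h
    obtain ⟨m, o', rfl, hm, ho', he⟩ := ih h₂
    refine ⟨o₁ ++ .letter a :: m, o', by simp, ?_, ho', fun v n e hmem => ?_⟩
    · rw [readWord_append, h₁, readWord_letter, hm, List.nil_append]
    · rw [opEvents_append, List.mem_append, h₁] at hmem
      rw [List.length_cons]
      rcases hmem with hmem | hmem
      · have := (bounds_of_mem_opEvents hmem).2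
        rw [h₁, List.length_nil] at this
        omega
      · have := he v (n + 1) e hmem
        omega

/-- A factor `u ≠ []` of the document is read by labels that execute operations only strictly
inside `u`. -/
theorem exists_append_of_readWord_eq_append_append {o : List (Label Sig V)} {x u y : List Sig}
    (hu : u ≠ []) (h : readWord o = x ++ (u ++ y)) :
    ∃ o₁ m o₂, o = o₁ ++ (m ++ o₂) ∧ readWord o₁ = x ∧ readWord m = u ∧ readWord o₂ = y ∧
      ∀ v n, ∀ e ∈ opEvents v n m, n < e.1 ∧ e.1 < n + u.length := by
  cases u with
  | nil => exact absurd rfl hu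
  | cons a u =>
    obtain ⟨o₁, o', rfl, h₁, h'⟩ := List.filterMap_eq_append_iff.1 h
    obtain ⟨o₂, o'', rfl, h₂, h''⟩ := exists_append_of_readWord_eq_cons h'
    obtain ⟨m, o₃, rfl, hm, h₃, he⟩ := exists_append_of_readWord_eq_append h''
    refine ⟨o₁ ++ o₂, .letter a :: m, o₃, by simp, ?_, ?_, h₃, fun v n e hmem => ?_⟩
    · rw [readWord_append, h₂, List.append_nil]
      exact h₁
    · rw [readWord_letter, hm]
    · have h₄ := he v (n + 1) e hmem
      have h₅ := (bounds_of_mem_opEvents (n := n + 1) hmem).1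
      rw [List.length_cons]
      omega

/-- Exchanging a factor read without operations shifts the later operations. -/
theorem opEvents_exchange {v : V} {o₁ m m' o₂ : List (Label Sig V)} (hm : opEvents v 0 m = [])
    (hm' : opEvents v 0 m' = []) (hne : readWord m ≠ []) :
    opEvents v 0 (o₁ ++ (m' ++ o₂)) = (opEvents v 0 (o₁ ++ (m ++ o₂))).map fun e =>
      (if e.1 ≤ (readWord o₁).length then e.1
        else e.1 - (readWord m).length + (readWord m').length, e.2) := by
  -- Because `m` reads at least one letter, positions in `o₁` and positions in `o₂` are disjoint, so
  -- the position alone decides whether an operation is shifted.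
  have hpos := List.length_pos_iff.2 hne
  rw [opEvents_append, opEvents_append, opEvents_append, opEvents_append,
    opEvents_eq_nil_of_eq_nil hm, opEvents_eq_nil_of_eq_nil hm', List.nil_append, List.nil_append,
    List.map_append]
  congr 1
  · refine ((List.map_congr_left fun e he => ?_).trans (List.map_id _)).symm
    have := (bounds_of_mem_opEvents he).2
    rw [if_pos (by omega), id]
  · rw [← Nat.zero_add (0 + _ + (readWord m').length), opEvents_add,
      ← Nat.zero_add (0 + _ + (readWord m).length), opEvents_add, List.map_map]
    refine List.map_congr_left fun e _ => ?_
    simp only [Function.comp_apply, Prod.mk.injEq, and_true]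
    rw [if_neg (by omega)]
    omega

end Substitution

/-! ### Concatenated tuples with their spans -/

section Concatenation

variable {Sig Var : Type*} {V : Finset Var} {k : ℕ}

/-- The length of the first `j` strings of `w` together. -/
def prefixLength (w : Fin k → List Sig) (j : ℕ) : ℕ := ((List.ofFn w).take j).flatten.length

theorem ofFn_update {α : Type*} (w : Fin k → α) (i : Fin k) (u : α) :
    List.ofFn (Function.update w i u) =
      (List.ofFn w).take i ++ u :: (List.ofFn w).drop (i + 1) := by
  have h : List.ofFn (Function.update w i u) = (List.ofFn w).set i u := by
    refine List.ext_getElem (by simp) fun n h₁ h₂ => ?_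
    simp only [List.getElem_ofFn, List.getElem_set, Function.update_apply, Fin.ext_iff, eq_comm]
  rw [h, List.set_eq_take_append_cons_drop, if_pos (by simp)]

theorem flatten_ofFn_update (w : Fin k → List Sig) (i : Fin k) (u : List Sig) :
    (List.ofFn (Function.update w i u)).flatten =
      ((List.ofFn w).take i).flatten ++ (u ++ ((List.ofFn w).drop (i + 1)).flatten) := by
  rw [ofFn_update, List.flatten_append, List.flatten_cons]

theorem flatten_ofFn (w : Fin k → List Sig) (i : Fin k) :
    (List.ofFn w).flatten =
      ((List.ofFn w).take i).flatten ++ (w i ++ ((List.ofFn w).drop (i + 1)).flatten) := by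
  conv_lhs => rw [← Function.update_eq_self i w]
  rw [flatten_ofFn_update]

theorem prefixLength_update_of_le (w : Fin k → List Sig) {i : Fin k} (u : List Sig) {j : ℕ}
    (h : j ≤ i) : prefixLength (Function.update w i u) j = prefixLength w j := by
  have hi := i.is_lt
  rw [prefixLength, prefixLength, ofFn_update, List.take_append_of_le_length (by simp; omega),
    List.take_take, min_eq_left h]

theorem prefixLength_update_of_lt (w : Fin k → List Sig) {i : Fin k} (u : List Sig) {j : ℕ}
    (h : (i : ℕ) < j) : prefixLength (Function.update w i u) j =
      prefixLength w i + (u.length +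
        (((List.ofFn w).drop (i + 1)).take (j - i - 1)).flatten.length) := by
  have hi := i.is_lt
  obtain ⟨c, rfl⟩ : ∃ c, j = i + (c + 1) := ⟨j - i - 1, by omega⟩
  have hlen : ((List.ofFn w).take i).length = i := by simp
  rw [prefixLength, prefixLength, ofFn_update]
  nth_rw 1 [← hlen]
  rw [List.take_length_add_append, List.take_succ_cons, List.flatten_append, List.flatten_cons,
    List.length_append, List.length_append]
  congr 5
  omega

theorem prefixLength_of_lt (w : Fin k → List Sig) {i : Fin k} {j : ℕ} (h : (i : ℕ) < j) :
    prefixLength w j = prefixLength w i + ((w i).length +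
      (((List.ofFn w).drop (i + 1)).take (j - i - 1)).flatten.length) := by
  conv_lhs => rw [← Function.update_eq_self i w]
  rw [prefixLength_update_of_lt w _ h]

theorem prefixLength_succ (w : Fin k → List Sig) (i : Fin k) :
    prefixLength w (i + 1) = prefixLength w i + (w i).length := by
  rw [prefixLength_of_lt w (Nat.lt_succ_self _)]
  simp

theorem prefixLength_mono (w : Fin k → List Sig) {i j : ℕ} (h : i ≤ j) :
    prefixLength w i ≤ prefixLength w j := by
  obtain ⟨c, rfl⟩ := Nat.exists_eq_add_of_le h
  rw [prefixLength, prefixLength, List.take_add, List.flatten_append, List.length_append]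
  exact Nat.le_add_right _ _

/-- The spans of the strings of `w` in their concatenation, assigned to variables. -/
def concatSpans (f : Fin k ≃ V) (w : Fin k → List Sig) : V → Span (List.ofFn w).flatten :=
  fun v =>
    { left := prefixLength w (f.symm v)
      right := prefixLength w (f.symm v + 1)
      left_le_right := prefixLength_mono w (Nat.le_succ _)
      right_le_length := by
        rw [prefixLength_succ, flatten_ofFn w (f.symm v), prefixLength, List.length_append,
          List.length_append]
        omega }

theorem substring_concatSpans (f : Fin k ≃ V) (w : Fin k → List Sig) (i : Fin k) :
    (concatSpans f w (f i)).substring = w i := by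
  rw [Span.substring, concatSpans]
  simp only [f.symm_apply_apply]
  rw [prefixLength_succ, Nat.add_sub_cancel_left, prefixLength, flatten_ofFn w i, List.drop_left,
    List.take_left]

/-- Labels that open, read and close one string after the other. -/
def concatLabels (f : Fin k ≃ V) (w : Fin k → List Sig) : List (Label Sig V) :=
  (List.ofFn fun i => .opening (f i) :: ((w i).map Label.letter ++ [.closing (f i)])).flatten

theorem readWord_flatten (os : List (List (Label Sig V))) :
    readWord os.flatten = (os.map readWord).flatten :=
  List.filterMap_flatten

theorem eps_notMem_concatLabels (f : Fin k ≃ V) (w : Fin k → List Sig) :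
    Label.eps ∉ concatLabels f w := by
  simp [concatLabels, List.mem_ofFn]

theorem map_readWord_ofFn (f : Fin k ≃ V) (w : Fin k → List Sig) :
    (List.ofFn fun i => .opening (f i) :: ((w i).map Label.letter ++ [.closing (f i)])).map
      (readWord (V := V)) = List.ofFn w := by
  rw [List.map_ofFn]
  congr 1
  funext i
  rw [Function.comp_apply, readWord_opening, readWord_append, readWord_map_letter]
  exact List.append_nil _

theorem readWord_concatLabels (f : Fin k ≃ V) (w : Fin k → List Sig) :
    readWord (concatLabels f w) = (List.ofFn w).flatten := by
  rw [concatLabels, readWord_flatten, map_readWord_ofFn]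

theorem opEvents_concatLabels (f : Fin k ≃ V) (w : Fin k → List Sig) (v : V) :
    opEvents v 0 (concatLabels f w) =
      [((concatSpans f w v).left, true), ((concatSpans f w v).right, false)] := by
  obtain ⟨i, rfl⟩ := f.surjective v
  set g : Fin k → List (Label Sig V) :=
    fun i => .opening (f i) :: ((w i).map Label.letter ++ [.closing (f i)]) with hg
  have hread : readWord ((List.ofFn g).take i).flatten = ((List.ofFn w).take i).flatten := by
    rw [readWord_flatten, List.map_take, map_readWord_ofFn]
  have hnil : ∀ os : List (List (Label Sig V)), (∀ o ∈ os, ∃ j, j ≠ i ∧ o = g j) →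
      opEvents (f i) 0 os.flatten = [] := by
    intro os hos
    rw [opEvents_eq_nil_iff]
    intro b hb
    obtain ⟨o, ho, hb⟩ := List.mem_flatten.1 hb
    obtain ⟨j, hj, rfl⟩ := hos o ho
    cases b <;> simp [hg, Label.marker] at hb <;> exact hj hb.symm
  -- Only block `i` operates on `f i`; the blocks before and after it contribute no events because
  -- `f` is injective.
  refine opEvents_eq_pair_iff.2 ⟨((List.ofFn g).take i).flatten, (w i).map Label.letter,
    ((List.ofFn g).drop (i + 1)).flatten, ?_, hnil _ fun o ho => ?_, opEvents_map_letter _ _ _,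
    hnil _ fun o ho => ?_, ?_, ?_⟩
  · rw [concatLabels, flatten_ofFn g i]
    simp [hg]
  · obtain ⟨j, hj, rfl⟩ := List.mem_take_iff_getElem.1 ho
    rw [lt_min_iff, List.length_ofFn] at hj
    exact ⟨⟨j, hj.2⟩, fun h => by rw [← h] at hj; exact lt_irrefl _ hj.1, by simp⟩
  · obtain ⟨j, hj, rfl⟩ := List.mem_drop_iff_getElem.1 ho
    rw [List.length_ofFn] at hj
    refine ⟨⟨j + (i + 1), by omega⟩, fun h => ?_, by simp [Nat.add_comm]⟩
    have := congrArg Fin.val h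
    simp only at this
    omega
  · rw [hread, concatSpans]
    simp only [f.symm_apply_apply]
    rfl
  · rw [hread, readWord_map_letter, concatSpans]
    simp only [f.symm_apply_apply]
    rw [prefixLength_succ]
    rfl

end Concatenation

/-! ### A Myhill–Nerode criterion for recognizability -/

section Recognizable

variable {Sig : Type*} {k : ℕ}

/-- The left quotient by `x` depends only on `cls x`, so there are finitely many quotients and
Myhill–Nerode applies. -/
theorem isRegular_setOf_eq_of_finite {C : Type*} [Finite C] {cls : List Sig → C}
    (hcls : ∀ x x' y, cls x = cls x' → cls (x ++ y) = cls (x' ++ y)) (c : C) :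
    Language.IsRegular ({u | cls u = c} : Language Sig) := by
  refine Language.isRegular_iff_finite_range_leftQuotient.2 ?_
  have hfac : Function.FactorsThrough
      (Language.leftQuotient ({u | cls u = c} : Language Sig)) cls := by
    intro x x' h
    refine Set.ext fun y => ?_
    change cls (x ++ y) = c ↔ cls (x' ++ y) = c
    rw [hcls x x' y h]
  refine (Set.finite_range (Function.extend cls
    (Language.leftQuotient ({u | cls u = c} : Language Sig)) fun _ => 0)).subset ?_
  rintro _ ⟨x, rfl⟩
  exact ⟨cls x, hfac.extend_apply _ x⟩

/-- A relation is recognizable if it is closed under exchanging single strings with strings in the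
same class, for finitely many classes respected by appending strings. -/
theorem isRecognizable_of_finite_classes {C : Type*} [Finite C] {cls : List Sig → C}
    (hcls : ∀ x x' y, cls x = cls x' → cls (x ++ y) = cls (x' ++ y))
    {R : Set (Fin k → List Sig)}
    (hR : ∀ w ∈ R, ∀ i u, cls (w i) = cls u → Function.update w i u ∈ R) :
    IsRecognizable R := by
  have hsat : ∀ w ∈ R, ∀ w', (∀ i, cls (w i) = cls (w' i)) → w' ∈ R := by
    intro w hw w' h
    -- Coordinates are exchanged one at a time, as `hR` changes a single string.
    have key : ∀ s : Finset (Fin k), s.piecewise w' w ∈ R := by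
      intro s
      induction s using Finset.induction_on with
      | empty => rwa [Finset.piecewise_empty]
      | insert i s hi ih =>
        rw [Finset.piecewise_insert]
        refine hR _ ih i _ ?_
        rw [Finset.piecewise_eq_of_notMem _ _ _ hi, h]
    simpa using key Finset.univ
  -- One Cartesian product for each tuple of classes realized in `R`.
  obtain ⟨n, ⟨e⟩⟩ := Finite.exists_equiv_fin {c : Fin k → C | ∃ w ∈ R, ∀ i, cls (w i) = c i}
  refine ⟨n, fun m j => {u | cls u = (e.symm m).1 j},
    fun m j => isRegular_setOf_eq_of_finite hcls _, Set.ext fun w => ?_⟩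
  rw [Set.mem_iUnion]
  constructor
  · intro hw
    let c : {c : Fin k → C | ∃ w ∈ R, ∀ i, cls (w i) = c i} :=
      ⟨fun i => cls (w i), w, hw, fun _ => rfl⟩
    exact ⟨e c, fun j => congrFun (congrArg Subtype.val (e.symm_apply_apply c).symm) j⟩
  · rintro ⟨m, hm⟩
    obtain ⟨w', hw', h⟩ := (e.symm m).2
    exact hsat w' hw' w fun i => (h i).trans (hm i).symm

end Recognizable

/-! ### From selectability to recognizability -/

section Converse

variable {K Sig Var : Type*} [CommSemiring K] {V : Finset Var} {k : ℕ}

/-- The concatenation of the strings of `w`, with the spans of these strings, has a run of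
weight `1`. -/
def AcceptsConcat (A : WeightedVSetAutomaton K Sig V) (f : Fin k ≃ V)
    (w : Fin k → List Sig) : Prop :=
  ∃ o, readWord o = (List.ofFn w).flatten ∧
    (∀ v, opEvents v 0 o =
      [((concatSpans f w v).left, true), ((concatSpans f w v).right, false)]) ∧
    ∃ p q, A.initialWeight p = 1 ∧ A.UnitWalk p o q ∧ A.finalWeight q = 1

/-- All operations of the run sit at boundaries between the strings of `w`, so the labels strictly
inside `w i` contain none. That stretch of the walk can be replaced by one reading `u` between the
same two states. -/
theorem AcceptsConcat.update {A : WeightedVSetAutomaton K Sig V} {f : Fin k ≃ V}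
    {w : Fin k → List Sig} (h : AcceptsConcat A f w) {i : Fin k} {u : List Sig} (hw : w i ≠ [])
    (hwu : A.readRelation (w i) = A.readRelation u) :
    AcceptsConcat A f (Function.update w i u) := by
  obtain ⟨o, hread, hev, p, q, hp, ho, hq⟩ := h
  rw [flatten_ofFn w i] at hread
  obtain ⟨o₁, m, o₂, rfl, h₁, hm, h₂, hin⟩ :=
    exists_append_of_readWord_eq_append_append hw hread
  have hl₁ : (readWord o₁).length = prefixLength w i := by rw [h₁, prefixLength]
  have hnil : ∀ v, opEvents v 0 m = [] := by
    intro v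
    have hnil' : opEvents v (prefixLength w i) m = [] := by
      refine List.eq_nil_iff_forall_not_mem.2 fun e he => ?_
      have hb := hin v _ e he
      have hmem : e ∈ opEvents v 0 (o₁ ++ (m ++ o₂)) := by
        rw [opEvents_append, opEvents_append, hl₁, Nat.zero_add]
        simp [he]
      have hpos : ∃ j, e.1 = prefixLength w j := by
        rw [hev v] at hmem
        simp only [List.mem_cons, List.not_mem_nil, or_false] at hmem
        rcases hmem with rfl | rfl
        · exact ⟨_, rfl⟩
        · exact ⟨_, rfl⟩
      obtain ⟨j, hj⟩ := hpos
      -- An operation inside `w i` would put the boundary `j` strictly between the consecutive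
      -- boundaries `i` and `i + 1`.
      rw [hj, ← prefixLength_succ] at hb
      rcases Nat.lt_or_ge i j with hij | hij
      · have := prefixLength_mono w (Nat.succ_le_of_lt hij)
        simp only [Nat.succ_eq_add_one] at this
        omega
      · have := prefixLength_mono w hij
        omega
    exact opEvents_eq_nil_of_eq_nil hnil' 0
  obtain ⟨r, hr, hwalk⟩ := WeightedVSetAutomaton.unitWalk_append.1 ho
  obtain ⟨s, hs, hs'⟩ := WeightedVSetAutomaton.unitWalk_append.1 hwalk
  have hrs : (r, s) ∈ A.readRelation u := hwu ▸ ⟨m, hm, hnil, hs⟩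
  obtain ⟨m', hm', hnil', hwalk'⟩ := hrs
  refine ⟨o₁ ++ (m' ++ o₂), ?_, fun v => ?_, p, q, hp, WeightedVSetAutomaton.unitWalk_append.2
    ⟨r, hr, WeightedVSetAutomaton.unitWalk_append.2 ⟨s, hwalk', hs'⟩⟩, hq⟩
  · rw [readWord_append, readWord_append, h₁, hm', h₂, flatten_ofFn_update]
  -- As `w i` is nonempty, the boundaries at most `prefixLength w i` are exactly those with `j ≤ i`;
  -- the new string moves all others.
  · have hshift : ∀ j, (if prefixLength w j ≤ prefixLength w i then prefixLength w j
        else prefixLength w j - (w i).length + u.length) =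
          prefixLength (Function.update w i u) j := by
      intro j
      rcases Nat.lt_or_ge i j with hij | hij
      · have := List.length_pos_iff.2 hw
        rw [prefixLength_update_of_lt w u hij, prefixLength_of_lt w hij, if_neg (by omega)]
        omega
      · rw [prefixLength_update_of_le w u hij, if_pos (prefixLength_mono w hij)]
    rw [opEvents_exchange (hnil v) (hnil' v) (by rwa [hm]), hev v, hl₁, hm, hm']
    simp only [concatSpans, List.map_cons, List.map_nil, hshift]

/-- Over bipotent semirings in which `1` has no proper divisors, relations that preserve
regularity are recognizable. -/
theorem IsSelectable.isRecognizable [Finite Sig] [Infinite Var] [Nontrivial K]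
    (hK : IsBipotent K) (hK' : ∀ a b : K, a * b = 1 → a = 1 ∧ b = 1)
    {R : Set (Fin k → List Sig)} (hR : IsSelectable K Var R) : IsRecognizable R := by
  classical
  let e : Fin k ↪ Var := Fin.valEmbedding.trans (Infinite.natEmbedding Var)
  let V : Finset Var := Finset.univ.map e
  let f : Fin k ≃ V := Equiv.ofBijective (fun i => ⟨e i, by simp [V]⟩)
    ⟨fun i j h => e.injective (congrArg Subtype.val h), fun ⟨v, hv⟩ => by
      obtain ⟨i, -, hi⟩ := Finset.mem_map.1 hv
      exact ⟨i, Subtype.ext hi⟩⟩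
  obtain ⟨A, hA, hS⟩ := hR V (WeightedVSetAutomaton.unitAutomaton K Sig V).annotator
    ⟨_, WeightedVSetAutomaton.unitAutomaton_noEpsCycle, rfl⟩ f
  have hmem : ∀ w, w ∈ R ↔ AcceptsConcat A f w := by
    intro w
    have hval : A.annotator _ (concatSpans f w) = if w ∈ R then 1 else 0 := by
      rw [hS, Annotator.select, WeightedVSetAutomaton.annotator_unitAutomaton hK hK'
        (readWord_concatLabels f w) (opEvents_concatLabels f w) (eps_notMem_concatLabels f w),
        one_mul]
      simp only [substring_concatSpans]
    have hiff : w ∈ R ↔ A.annotator _ (concatSpans f w) = 1 := by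
      rw [hval]
      split_ifs with h <;> simp [h]
    -- The selected annotator takes only the values `0` and `1` here, which is what lets a single
    -- run of weight `1` decide membership.
    have h01 : A.annotator _ (concatSpans f w) = 0 ∨ A.annotator _ (concatSpans f w) = 1 := by
      rw [hval]
      split_ifs <;> simp
    rw [hiff, AcceptsConcat, ← WeightedVSetAutomaton.exists_run_weight_eq_one_iff hK']
    exact hK.finsum_mem_eq_one_iff (hA.finite_validRuns _ _) h01
  have := A.finite_state
  -- The component `u = []` isolates the empty string. If `w i` is empty, several operations may
  -- share one position in any order, so no stretch free of operations need separate them and the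
  -- exchange argument fails; in that class there is nothing to exchange.
  refine isRecognizable_of_finite_classes (C := Set (A.State × A.State) × Prop)
    (cls := fun u => (A.readRelation u, u = [])) ?_ ?_
  · intro x x' y h
    rw [Prod.mk.injEq] at h ⊢
    refine ⟨Set.ext fun s => ?_, ?_⟩
    · rw [WeightedVSetAutomaton.mem_readRelation_append, h.1,
        WeightedVSetAutomaton.mem_readRelation_append]
    · rw [List.append_eq_nil_iff, List.append_eq_nil_iff, h.2]
  · intro w hw i u h
    rw [Prod.mk.injEq] at h
    by_cases hwi : w i = []
    · rw [(h.2 ▸ hwi : u = []), ← hwi, Function.update_eq_self]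
      exact hw
    · exact (hmem _).2 (((hmem w).1 hw).update hwi h.1)

end Converse

/-! ### The Łukasiewicz semiring -/

namespace Lukasiewicz

instance : Nontrivial Lukasiewicz :=
  ⟨0, 1, fun h => zero_ne_one (congrArg val h)⟩

theorem isBipotent : IsBipotent Lukasiewicz := fun a b =>
  (max_choice a.val b.val).imp Lukasiewicz.ext Lukasiewicz.ext

theorem eq_one_of_mul_eq_one (a b : Lukasiewicz) (h : a * b = 1) : a = 1 ∧ b = 1 := by
  have h' := congrArg val h
  rw [val_mul, val_one] at h'
  have ha := a.le_one
  have hb := b.le_one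
  have hab : 1 ≤ a.val + b.val - 1 := by
    rcases max_choice 0 (a.val + b.val - 1) with hm | hm <;> linarith
  exact ⟨Lukasiewicz.ext (by rw [val_one]; linarith), Lukasiewicz.ext (by rw [val_one]; linarith)⟩

theorem not_isPositive : ¬ IsPositive Lukasiewicz := by
  rintro ⟨-, -, h⟩
  -- A zero divisor: `1/2 + 1/2 - 1 = 0`.
  let x : Lukasiewicz := ⟨1 / 2, by norm_num, by norm_num⟩
  have hx : x * x = 0 := Lukasiewicz.ext (by rw [val_mul, val_zero]; norm_num [x])
  have hx0 : x.val = 0 := congrArg val ((h x x hx).elim id id)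
  norm_num [x] at hx0

end Lukasiewicz

end KAnnotators

theorem mainTheorem10 {Sig : Type*} [Finite Sig] {Var : Type*} [Infinite Var]
    {k : ℕ} (R : Set (Fin k → List Sig)) :
    (∀ (K : Type*) [CommSemiring K] [Nontrivial K], KAnnotators.IsBipotent K →
      (∀ a b : K, a * b = 1 → a = 1 ∧ b = 1) →
      (KAnnotators.IsRecognizable R ↔ KAnnotators.IsSelectable K Var R)) ∧
    ¬ KAnnotators.IsPositive KAnnotators.Lukasiewicz ∧
    (KAnnotators.IsRecognizable R ↔
      KAnnotators.IsSelectable KAnnotators.Lukasiewicz Var R) :=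
  ⟨fun _ _ _ hK hK' => ⟨fun h => h.isSelectable, fun h => h.isRecognizable hK hK'⟩,
    KAnnotators.Lukasiewicz.not_isPositive,
    fun h => h.isSelectable, fun h => h.isRecognizable KAnnotators.Lukasiewicz.isBipotent
      KAnnotators.Lukasiewicz.eq_one_of_mul_eq_one⟩
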